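/- Let $p$ be a prime and let $T_p$ be the $p$-regular rooted tree, whose vertices are the finite words in a $p$-letter alphabet, the words of length $n$ forming level $n$. For $g\in\mathrm{Aut}\,T_p$ and a vertex $v$, the section $g|_v\in\mathrm{Aut}\,T_p$ is defined by $(vu)^g=v^g\,u^{g|_v}$ for all words $u$, and the label of $g$ at $v$ is the permutation of the alphabet by which $g|_v$ acts on the first level. Let $\sigma$ be a fixed $p$-cycle on the alphabet, and let $W_p\le\mathrm{Aut}\,T_p$ be the group of all automorphisms whose labels all lie in $\langle\sigma\rangle$. Write $\mathrm{St}_{W_p}(n)$ for the pointwise stabilizer of level $n$ in $W_p$, and let $\mathrm{hdim}_{W_p}$ denote Hausdorff dimension with respect to the metric $d(g,h)=\inf\{|W_p:\mathrm{St}_{W_p}(n)|^{-1} : g^{-1}h\in \mathrm{St}_{W_p}(n)\}$ on $W_p$. A subgroup $G\le \mathrm{Aut}\,T_p$ is fractal if it contains all sections of its elements, acts transitively on every level, and for every vertex $v$ the map $\mathrm{st}_G(v)\to G$, $g\mapsto g|_v$, is surjective. It is weakly branch if it acts transitively on every level and, for every $n\ge 0$, the subgroup $\mathrm{Rist}_G(n)=\prod_{v}\mathrm{rist}_G(v)$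 is infinite, where $v$ runs over the vertices of level $n$ and $\mathrm{rist}_G(v)$ consists of the elements of $G$ that fix every vertex outside the subtree rooted at $v$. A weakly branch action of an abstract group $\Gamma$ on $T_p$ is an injective homomorphism $\rho:\Gamma\to\mathrm{Aut}\,T_p$ such that $\rho(\Gamma)$ is weakly branch. The group $\Gamma$ is $T_p$-rigid if it admits a weakly branch action on $T_p$ and for any two weakly branch actions $\rho,\tau$ of $\Gamma$ on $T_p$ the images $\rho(\Gamma)$ and $\tau(\Gamma)$ are conjugate in $\mathrm{Aut}\,T_p$. **Corollary.** Let $G\le W_p$ be a fractal weakly branch group such that its closure $\overline{G}$ in $W_p$ (in the topology of the above metric) satisfies $$\mathrm{hdim}_{W_p}(\overline{G})>\frac1p .$$ Then $G$ is $T_p$-rigid. -/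

import Mathlib

open scoped ENNReal

/-- Vertices of the `d`-regular rooted tree `T_d`: finite words over a `d`-letter alphabet.
The root is the empty word, `v` lies at level `v.length`, and `u` is a descendant of `v`
iff `v` is a prefix of `u`. -/
abbrev Vertex (d : ℕ) : Type := List (Fin d)

/-- `Aut T_d`: the permutations of the vertices that preserve the levels and the
ancestor-descendant relation (written as functions acting on the left). -/
def treeAut (d : ℕ) : Subgroup (Equiv.Perm (Vertex d)) where
  carrier := {g | (∀ v, (g v).length = v.length) ∧ ∀ u v, g u <+: g v ↔ u <+: v}
  one_mem' := by simp
  mul_mem' := by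
    rintro a b ⟨ha, ha'⟩ ⟨hb, hb'⟩
    refine ⟨fun v => ?_, fun u v => ?_⟩
    · rw [Equiv.Perm.mul_apply, ha, hb]
    · rw [Equiv.Perm.mul_apply, Equiv.Perm.mul_apply, ha', hb']
  inv_mem' := by
    rintro a ⟨ha, ha'⟩
    refine ⟨fun v => ?_, fun u v => ?_⟩
    · have h := ha (a⁻¹ v)
      rw [show a (a⁻¹ v) = v from a.apply_symm_apply v] at h
      exact h.symm
    · have h := ha' (a⁻¹ u) (a⁻¹ v)
      rw [show a (a⁻¹ u) = u from a.apply_symm_apply u,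
        show a (a⁻¹ v) = v from a.apply_symm_apply v] at h
      exact h.symm

/-- The type of automorphisms of the rooted tree `T_d`. -/
abbrev TreeAut (d : ℕ) : Type := ↥(treeAut d)

namespace TreeAut

variable {d : ℕ}

theorem length_apply (g : TreeAut d) (v : Vertex d) : (g.1 v).length = v.length := g.2.1 v

theorem apply_append (g : TreeAut d) (v u : Vertex d) :
    g.1 v ++ (g.1 (v ++ u)).drop v.length = g.1 (v ++ u) := by
  have h : g.1 v <+: g.1 (v ++ u) := (g.2.2 _ _).2 (List.prefix_append v u)
  obtain ⟨t, ht⟩ := h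
  rw [← ht, ← length_apply g v, List.drop_left]

theorem inv_apply_append (g : TreeAut d) (v u : Vertex d) :
    v ++ ((g⁻¹).1 (g.1 v ++ u)).drop v.length = (g⁻¹).1 (g.1 v ++ u) := by
  have h := apply_append g⁻¹ (g.1 v) u
  have h2 : (g⁻¹).1 (g.1 v) = v := g.1.symm_apply_apply v
  rw [h2, length_apply] at h
  exact h

/-- The permutation underlying the section `g|_v`. -/
def secPerm (g : TreeAut d) (v : Vertex d) : Equiv.Perm (Vertex d) where
  toFun u := (g.1 (v ++ u)).drop v.length
  invFun u := ((g⁻¹).1 (g.1 v ++ u)).drop v.length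
  left_inv u := by
    change ((g⁻¹).1 (g.1 v ++ (g.1 (v ++ u)).drop v.length)).drop v.length = u
    rw [apply_append]
    have : (g⁻¹).1 (g.1 (v ++ u)) = v ++ u := g.1.symm_apply_apply _
    rw [this, List.drop_left]
  right_inv u := by
    change (g.1 (v ++ ((g⁻¹).1 (g.1 v ++ u)).drop v.length)).drop v.length = u
    rw [inv_apply_append]
    have : g.1 ((g⁻¹).1 (g.1 v ++ u)) = g.1 v ++ u := g.1.apply_symm_apply _
    rw [this, ← length_apply g v, List.drop_left]

theorem secPerm_spec (g : TreeAut d) (v u : Vertex d) :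
    g.1 (v ++ u) = g.1 v ++ secPerm g v u := (apply_append g v u).symm

/-- The section `g|_v`, i.e. the automorphism of `T_d` with
`g (v ++ u) = g v ++ (g|_v) u` for all `u`. -/
def sec (g : TreeAut d) (v : Vertex d) : TreeAut d :=
  ⟨secPerm g v, by
    refine ⟨fun u => ?_, fun u w => ?_⟩
    · have h := congrArg List.length (secPerm_spec g v u)
      rw [length_apply, List.length_append, List.length_append, length_apply] at h
      omega
    · rw [← List.prefix_append_right_inj (g.1 v), ← secPerm_spec, ← secPerm_spec, g.2.2,
        List.prefix_append_right_inj]⟩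

theorem sec_spec (g : TreeAut d) (v u : Vertex d) :
    g.1 (v ++ u) = g.1 v ++ (sec g v).1 u := secPerm_spec g v u

theorem sec_unique {g : TreeAut d} {v : Vertex d} {h : TreeAut d}
    (H : ∀ u, g.1 (v ++ u) = g.1 v ++ h.1 u) : sec g v = h := by
  apply Subtype.ext
  apply Equiv.ext
  intro u
  exact List.append_cancel_left ((sec_spec g v u).symm.trans (H u))

theorem sec_one (v : Vertex d) : sec (1 : TreeAut d) v = 1 :=
  sec_unique fun _ => rfl

theorem sec_mul (g h : TreeAut d) (v : Vertex d) :
    sec (g * h) v = sec g (h.1 v) * sec h v :=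
  sec_unique fun u => by
    change g.1 (h.1 (v ++ u)) = g.1 (h.1 v) ++ (sec g (h.1 v)).1 ((sec h v).1 u)
    rw [sec_spec h, sec_spec g]

theorem ne_nil_of_singleton (g : TreeAut d) (x : Fin d) : g.1 [x] ≠ [] := by
  intro h
  have := length_apply g [x]
  rw [h] at this
  simp at this

theorem singleton_head (g : TreeAut d) (x : Fin d) :
    [(g.1 [x]).head (ne_nil_of_singleton g x)] = g.1 [x] := by
  have h := length_apply g [x]
  obtain ⟨y, hy⟩ := List.length_eq_one_iff.1 (h.trans rfl)
  simp [hy]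

/-- The permutation of the first level induced by `g`. -/
def rootPerm (g : TreeAut d) : Equiv.Perm (Fin d) where
  toFun x := (g.1 [x]).head (ne_nil_of_singleton g x)
  invFun x := ((g⁻¹).1 [x]).head (ne_nil_of_singleton g⁻¹ x)
  left_inv x := by
    apply List.singleton_injective
    change [((g⁻¹).1 [_]).head (ne_nil_of_singleton g⁻¹ _)] = [x]
    rw [singleton_head, singleton_head]
    exact g.1.symm_apply_apply _
  right_inv x := by
    apply List.singleton_injective
    change [(g.1 [_]).head (ne_nil_of_singleton g _)] = [x]
    rw [singleton_head, singleton_head]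
    exact g.1.apply_symm_apply _

theorem rootPerm_spec (g : TreeAut d) (x : Fin d) : g.1 [x] = [rootPerm g x] :=
  (singleton_head g x).symm

theorem rootPerm_one : rootPerm (1 : TreeAut d) = 1 := by
  ext x
  rfl

theorem rootPerm_mul (g h : TreeAut d) : rootPerm (g * h) = rootPerm g * rootPerm h := by
  apply Equiv.ext
  intro x
  apply List.singleton_injective
  change [rootPerm (g * h) x] = [rootPerm g (rootPerm h x)]
  rw [← rootPerm_spec, ← rootPerm_spec, ← rootPerm_spec]
  rfl

/-- The label of `g` at `v`: the permutation with `g (v x) = (g v) (label x)`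
for every letter `x`. -/
def label (g : TreeAut d) (v : Vertex d) : Equiv.Perm (Fin d) := rootPerm (sec g v)

theorem label_spec (g : TreeAut d) (v : Vertex d) (x : Fin d) :
    g.1 (v ++ [x]) = g.1 v ++ [label g v x] := by
  rw [sec_spec, rootPerm_spec, label]

theorem label_one (v : Vertex d) : label (1 : TreeAut d) v = 1 := by
  rw [label, sec_one, rootPerm_one]

theorem label_mul (g h : TreeAut d) (v : Vertex d) :
    label (g * h) v = label g (h.1 v) * label h v := by
  rw [label, sec_mul, rootPerm_mul, label, label]

end TreeAut

/-- The group `W_p` of `p`-adic automorphisms: the automorphisms all of whose labels are powers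
of the cycle `σ = (0 1 ⋯ p-1)`. -/
def padicAut (p : ℕ) : Subgroup (TreeAut p) where
  carrier := {g | ∀ v, g.label v ∈ Subgroup.zpowers (finRotate p)}
  one_mem' v := by
    rw [TreeAut.label_one]
    exact one_mem _
  mul_mem' {a b} ha hb v := by
    rw [TreeAut.label_mul]
    exact mul_mem (ha _) (hb _)
  inv_mem' {a} ha v := by
    have h := TreeAut.label_mul a a⁻¹ v
    rw [mul_inv_cancel, TreeAut.label_one] at h
    rw [eq_inv_of_mul_eq_one_right h.symm]
    exact inv_mem (ha _)

/-- The level stabilizer `St(n)` in `Aut T_d`: the automorphisms that fix every vertex of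
level `n`. -/
def levelStab (d n : ℕ) : Subgroup (TreeAut d) where
  carrier := {g | ∀ v : Vertex d, v.length = n → g.1 v = v}
  one_mem' _ _ := rfl
  mul_mem' {a b} ha hb v hv := by
    change a.1 (b.1 v) = v
    rw [hb v hv, ha v hv]
  inv_mem' {a} ha v hv := (Equiv.Perm.inv_eq_iff_eq (f := a.1)).2 (ha v hv).symm

/-- `G` acts transitively on every level. -/
def IsLevelTransitive {d : ℕ} (G : Subgroup (TreeAut d)) : Prop :=
  ∀ u v : Vertex d, u.length = v.length → ∃ g ∈ G, g.1 u = v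

/-- `G` contains all the sections of its elements. -/
def IsSelfSimilar {d : ℕ} (G : Subgroup (TreeAut d)) : Prop :=
  ∀ g ∈ G, ∀ v : Vertex d, g.sec v ∈ G

/-- `G` is self-similar, level-transitive, and for every vertex `v` the map
`st_G(v) → G`, `g ↦ g|_v`, is surjective. -/
def IsFractal {d : ℕ} (G : Subgroup (TreeAut d)) : Prop :=
  IsSelfSimilar G ∧ IsLevelTransitive G ∧
    ∀ v : Vertex d, ∀ h ∈ G, ∃ g ∈ G, g.1 v = v ∧ g.sec v = h

/-- The rigid vertex stabilizer `rist_G(v)`: the elements of `G` that fix every vertex outside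
the subtree of descendants of `v`. -/
def rist {d : ℕ} (G : Subgroup (TreeAut d)) (v : Vertex d) : Subgroup (TreeAut d) where
  carrier := {g | g ∈ G ∧ ∀ u : Vertex d, ¬ v <+: u → g.1 u = u}
  one_mem' := ⟨one_mem _, fun _ _ => rfl⟩
  mul_mem' {a b} ha hb := ⟨mul_mem ha.1 hb.1, fun u hu => by
    change a.1 (b.1 u) = u
    rw [hb.2 u hu, ha.2 u hu]⟩
  inv_mem' {a} ha := ⟨inv_mem ha.1, fun u hu =>
    (Equiv.Perm.inv_eq_iff_eq (f := a.1)).2 (ha.2 u hu).symm⟩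

/-- The rigid level stabilizer `Rist_G(n)`: the (internal direct) product of the rigid vertex
stabilizers of the vertices of level `n`. -/
def ristLevel {d : ℕ} (G : Subgroup (TreeAut d)) (n : ℕ) : Subgroup (TreeAut d) :=
  ⨆ v : {v : Vertex d // v.length = n}, rist G v.1

/-- A weakly branch group: level-transitive, with infinite rigid level stabilizers. -/
def IsWeaklyBranch {d : ℕ} (G : Subgroup (TreeAut d)) : Prop :=
  IsLevelTransitive G ∧ ∀ n : ℕ, Infinite (ristLevel G n)

/-- A weakly branch action of an abstract group on `T_d`: an embedding into `Aut T_d` whose image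
is weakly branch. -/
def IsWeaklyBranchAction {d : ℕ} {Γ : Type*} [Group Γ] (ρ : Γ →* TreeAut d) : Prop :=
  Function.Injective ρ ∧ IsWeaklyBranch ρ.range

/-- `Γ` is `T_d`-rigid: it has a weakly branch action on `T_d`, and the images of any two
weakly branch actions on `T_d` are conjugate in `Aut T_d`. -/
def IsTreeRigid (d : ℕ) (Γ : Type*) [Group Γ] : Prop :=
  (∃ ρ : Γ →* TreeAut d, IsWeaklyBranchAction ρ) ∧
    ∀ ρ τ : Γ →* TreeAut d, IsWeaklyBranchAction ρ → IsWeaklyBranchAction τ →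
      ∃ f : TreeAut d, ρ.range.map (MulAut.conj f).toMonoidHom = τ.range

theorem levelStab_antitone {d m n : ℕ} (h : m ≤ n) : levelStab d n ≤ levelStab d m := by
  intro g hg v hv
  by_cases hd : d = 0
  · subst hd
    cases v with
    | nil => exact List.eq_nil_of_length_eq_zero (g.2.1 [])
    | cons x _ => exact x.elim0
  · have hv' : (v ++ List.replicate (n - m) (⟨0, Nat.pos_of_ne_zero hd⟩ : Fin d)).length = n := by
      rw [List.length_append, List.length_replicate]
      omega
    have h1 := hg _ hv'
    rw [TreeAut.sec_spec] at h1
    exact (List.append_inj h1 (g.2.1 v)).1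

open Classical in
/-- The distance on `W_p` given by the filtration of level stabilizers:
`d(g, h)` is the infimum of `1 / |W_p : St_{W_p}(n)|` over the `n` with `g⁻¹ h ∈ St(n)`
(these indices are finite and tend to infinity, so the infimum vanishes for `g = h`). -/
noncomputable def padicEDist {p : ℕ} (g h : padicAut p) : ℝ≥0∞ :=
  if g = h then 0 else
    ⨅ n : {n : ℕ // g.1⁻¹ * h.1 ∈ levelStab p n},
      ((levelStab p n.1).relIndex (padicAut p) : ℝ≥0∞)⁻¹

theorem padicEDist_self {p : ℕ} (g : padicAut p) : padicEDist g g = 0 := if_pos rfl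

theorem padicEDist_of_ne {p : ℕ} {g h : padicAut p} (H : g ≠ h) :
    padicEDist g h = ⨅ n : {n : ℕ // g.1⁻¹ * h.1 ∈ levelStab p n},
      ((levelStab p n.1).relIndex (padicAut p) : ℝ≥0∞)⁻¹ := if_neg H

theorem padicEDist_le {p : ℕ} {g h : padicAut p} {n : ℕ} (H : g.1⁻¹ * h.1 ∈ levelStab p n) :
    padicEDist g h ≤ ((levelStab p n).relIndex (padicAut p) : ℝ≥0∞)⁻¹ := by
  by_cases hgh : g = h
  · rw [hgh, padicEDist_self]
    exact zero_le
  · rw [padicEDist_of_ne hgh]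
    exact iInf_le (fun n : {n : ℕ // g.1⁻¹ * h.1 ∈ levelStab p n} =>
      ((levelStab p n.1).relIndex (padicAut p) : ℝ≥0∞)⁻¹) ⟨n, H⟩

theorem padicEDist_le_swap {p : ℕ} (g h : padicAut p) : padicEDist g h ≤ padicEDist h g := by
  by_cases hgh : g = h
  · rw [hgh]
  · rw [padicEDist_of_ne (Ne.symm hgh)]
    refine le_iInf fun n => padicEDist_le ?_
    have h1 := inv_mem n.2
    rwa [mul_inv_rev, inv_inv] at h1

theorem padicEDist_triangle {p : ℕ} (g h k : padicAut p) :
    padicEDist g k ≤ padicEDist g h + padicEDist h k := by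
  by_cases hgh : g = h
  · rw [hgh, padicEDist_self, zero_add]
  by_cases hhk : h = k
  · rw [hhk, padicEDist_self, add_zero]
  rw [padicEDist_of_ne hgh, padicEDist_of_ne hhk, ENNReal.iInf_add]
  refine le_iInf fun n => ?_
  rw [ENNReal.add_iInf]
  refine le_iInf fun m => ?_
  have hmul : g.1⁻¹ * k.1 = (g.1⁻¹ * h.1) * (h.1⁻¹ * k.1) := by group
  rcases le_total n.1 m.1 with hnm | hnm
  · refine (padicEDist_le (n := n.1) ?_).trans le_self_add
    rw [hmul]
    exact mul_mem n.2 (levelStab_antitone hnm m.2)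
  · refine (padicEDist_le (n := m.1) ?_).trans le_add_self
    rw [hmul]
    exact mul_mem (levelStab_antitone hnm n.2) m.2

theorem padicEDist_eq_zero {p : ℕ} {g h : padicAut p} (H : padicEDist g h = 0) : g = h := by
  by_contra hne
  rw [padicEDist_of_ne hne] at H
  have hex : ∃ N, g.1⁻¹ * h.1 ∉ levelStab p N := by
    by_contra! hall
    apply hne
    have h1 : g.1⁻¹ * h.1 = 1 :=
      Subtype.ext (Equiv.ext fun v => hall v.length v rfl)
    exact Subtype.ext (inv_mul_eq_one.1 h1)
  obtain ⟨N, hN⟩ := hex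
  have hlt : ∀ n, g.1⁻¹ * h.1 ∈ levelStab p n → n < N := by
    intro n hn
    by_contra! hle
    exact hN (levelStab_antitone hle hn)
  have hfin : Finite {n : ℕ // g.1⁻¹ * h.1 ∈ levelStab p n} :=
    Set.Finite.to_subtype ((Set.finite_Iio N).subset fun n hn => hlt n hn)
  have hnon : Nonempty {n : ℕ // g.1⁻¹ * h.1 ∈ levelStab p n} :=
    ⟨⟨0, fun v hv => by
      rw [List.eq_nil_of_length_eq_zero hv]
      exact List.eq_nil_of_length_eq_zero (TreeAut.length_apply _ _)⟩⟩
  obtain ⟨n, hn⟩ := exists_eq_ciInf_of_finite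
    (f := fun n : {n : ℕ // g.1⁻¹ * h.1 ∈ levelStab p n} =>
      ((levelStab p n.1).relIndex (padicAut p) : ℝ≥0∞)⁻¹)
  rw [← hn] at H
  exact ENNReal.natCast_ne_top _ (ENNReal.inv_eq_zero.1 H)

/-- The metric structure on `W_p` induced by the filtration of level stabilizers. It also
provides the (congruence) topology of `W_p`. -/
noncomputable instance padicAutEMetricSpace (p : ℕ) : EMetricSpace (padicAut p) where
  edist := padicEDist
  edist_self := padicEDist_self
  edist_comm g h := le_antisymm (padicEDist_le_swap g h) (padicEDist_le_swap h g)
  edist_triangle := padicEDist_triangle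
  eq_of_edist_eq_zero := padicEDist_eq_zero

/-- The Hausdorff dimension `hdim_{W_p}` of a subset of `W_p`. -/
noncomputable def hdimW {p : ℕ} (S : Set (padicAut p)) : ℝ≥0∞ := dimH S

/-! Call `G` tied if, in its first level stabilizer, one trivial label on the first level forces all
of them to be trivial (`FirstLevelLabelsTied`). Tied groups are too small for the dimension
hypothesis, and untied ones are rigid.

If `G` is tied, self-similarity applies the constraint below every vertex: modulo `St(n+2)`, an
element of `St_G(n+1)` is determined by one label below each vertex of level `n`. So `log |G :
St_G(n)|` grows at most `1/p` times as fast as for `W_p`, up to a constant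
(`relIndex_levelStab_pow_le_of_tied`), and covering the closure by cosets of level stabilizers
bounds its dimension by `1/p` (`dimH_closure_le_of_tied`).

If `G` is not tied, let `τ` be any weakly branch action of `G`. Commutators in rigid stabilizers
show that each vertex stabilizer of `τ` contains one of the given action (`exists_vertexStab_le`).
Along a ray, the stabilizers of `τ` descend by index `p` at each step. The only subgroup of index
`p` above a vertex stabilizer of `G` is `St_G(1)`, since another one would be normal and, by
transitivity, would tie the labels (`IsFractal.eq_vertexStab_of_index_eq_prime`). Sections carry
this down the tree, so the chain consists of the stabilizers along a ray of the given action
(`IsFractal.chain_eq_vertexStab`). Transitive actions with equal stabilizers along two rays are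
conjugate (`exists_conj_of_rays`). -/

namespace TreeAut

variable {d : ℕ}

theorem mul_apply (g h : TreeAut d) (v : Vertex d) : (g * h).1 v = g.1 (h.1 v) := rfl

theorem inv_apply_self (g : TreeAut d) (v : Vertex d) : (g⁻¹).1 (g.1 v) = v :=
  g.1.symm_apply_apply v

theorem apply_inv_self (g : TreeAut d) (v : Vertex d) : g.1 ((g⁻¹).1 v) = v :=
  g.1.apply_symm_apply v

theorem ext_apply {g h : TreeAut d} (H : ∀ v, g.1 v = h.1 v) : g = h :=
  Subtype.ext (Equiv.ext H)

theorem inv_apply_eq {g : TreeAut d} {u v : Vertex d} : (g⁻¹).1 u = v ↔ u = g.1 v := by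
  constructor
  · rintro rfl
    exact (apply_inv_self g u).symm
  · rintro rfl
    exact inv_apply_self g v

end TreeAut

theorem List.eq_of_common_extension {α : Type*} {u v x : List α} (hu : u <+: x) (hv : v <+: x)
    (h : u.length = v.length) : u = v :=
  (List.prefix_of_prefix_length_le hu hv h.le).eq_of_length h

/-! ### Rigid stabilizers and the comparison of two weakly branch actions. -/

section Actions

variable {d : ℕ} {Γ : Type*} [Group Γ]

/-- The stabilizer of a vertex under an action on the tree. -/
def vertexStab (ρ : Γ →* TreeAut d) (v : Vertex d) : Subgroup Γ where
  carrier := {g | (ρ g).1 v = v}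
  one_mem' := by
    change (ρ 1).1 v = v
    rw [map_one]
    rfl
  mul_mem' {a b} ha hb := by
    change (ρ (a * b)).1 v = v
    change (ρ a).1 v = v at ha
    change (ρ b).1 v = v at hb
    rw [map_mul, TreeAut.mul_apply, hb, ha]
  inv_mem' {a} ha := by
    change (ρ a⁻¹).1 v = v
    rw [map_inv, TreeAut.inv_apply_eq]
    exact ha.symm

theorem mem_vertexStab {ρ : Γ →* TreeAut d} {v : Vertex d} {g : Γ} :
    g ∈ vertexStab ρ v ↔ (ρ g).1 v = v := Iff.rfl

/-- The rigid stabilizer of a vertex, as a subgroup of the acting group. -/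
def ristAct (ρ : Γ →* TreeAut d) (v : Vertex d) : Subgroup Γ := (rist ρ.range v).comap ρ

theorem mem_ristAct {ρ : Γ →* TreeAut d} {v : Vertex d} {g : Γ} :
    g ∈ ristAct ρ v ↔ ∀ u : Vertex d, ¬ v <+: u → (ρ g).1 u = u :=
  ⟨fun h => h.2, fun h => ⟨⟨g, rfl⟩, h⟩⟩

theorem ristAct_mono {ρ : Γ →* TreeAut d} {u v : Vertex d} (h : u <+: v) :
    ristAct ρ v ≤ ristAct ρ u := fun _ hg =>
  mem_ristAct.2 fun x hx => mem_ristAct.1 hg x fun hv => hx (h.trans hv)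

theorem conj_mem_ristAct {ρ : Γ →* TreeAut d} {v : Vertex d} {h : Γ} (hh : h ∈ ristAct ρ v)
    (g : Γ) : g * h * g⁻¹ ∈ ristAct ρ ((ρ g).1 v) := by
  refine mem_ristAct.2 fun u hu => ?_
  have h1 : ¬ v <+: ((ρ g)⁻¹).1 u := by
    rw [← (ρ g).2.2, TreeAut.apply_inv_self]
    exact hu
  rw [map_mul, map_mul, map_inv, TreeAut.mul_apply, TreeAut.mul_apply, mem_ristAct.1 hh _ h1,
    TreeAut.apply_inv_self]

theorem ristAct_le_vertexStab (ρ : Γ →* TreeAut d) (v : Vertex d) :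
    ristAct ρ v ≤ vertexStab ρ v := by
  intro g hg
  by_contra hne
  have h1 : ¬ v <+: (ρ g).1 v := fun h =>
    hne (h.eq_of_length (TreeAut.length_apply _ _).symm).symm
  exact hne ((ρ g).1.injective (mem_ristAct.1 hg _ h1))

theorem prefix_apply_iff_of_mem_vertexStab {ρ : Γ →* TreeAut d} {v : Vertex d} {g : Γ}
    (hg : g ∈ vertexStab ρ v) (x : Vertex d) : v <+: (ρ g).1 x ↔ v <+: x := by
  conv_lhs => rw [← mem_vertexStab.1 hg]
  exact (ρ g).2.2 v x

theorem eq_one_of_mem_ristAct {ρ : Γ →* TreeAut d} (hρ : Function.Injective ρ) {u v : Vertex d}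
    (huv : ∀ x, u <+: x → ¬ v <+: x) {g : Γ} (hu : g ∈ ristAct ρ u) (hv : g ∈ ristAct ρ v) :
    g = 1 := by
  apply hρ
  rw [map_one]
  refine TreeAut.ext_apply fun x => ?_
  by_cases hx : u <+: x
  · exact mem_ristAct.1 hv x (huv x hx)
  · exact mem_ristAct.1 hu x hx

theorem commute_of_mem_ristAct {ρ : Γ →* TreeAut d} (hρ : Function.Injective ρ) {u v : Vertex d}
    (huv : ∀ x, u <+: x → ¬ v <+: x) {g h : Γ} (hg : g ∈ ristAct ρ u) (hh : h ∈ ristAct ρ v) :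
    g * h = h * g := by
  apply hρ
  rw [map_mul, map_mul]
  refine TreeAut.ext_apply fun x => ?_
  rw [TreeAut.mul_apply, TreeAut.mul_apply]
  have hgu := prefix_apply_iff_of_mem_vertexStab (ristAct_le_vertexStab ρ u hg) x
  have hhv := prefix_apply_iff_of_mem_vertexStab (ristAct_le_vertexStab ρ v hh) x
  by_cases hx : u <+: x
  · rw [mem_ristAct.1 hh x (huv x hx), mem_ristAct.1 hh _ (huv _ (hgu.2 hx))]
  · rw [mem_ristAct.1 hg x hx, mem_ristAct.1 hg]
    intro hux
    by_cases hvx : v <+: x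
    · exact huv _ hux (hhv.2 hvx)
    · rw [mem_ristAct.1 hh x hvx] at hux
      exact hx hux

/-- Rigid stabilizers on one level are conjugate by transitivity, so if one were trivial the whole
rigid level stabilizer would be. -/
theorem exists_ristAct_ne_one {ρ : Γ →* TreeAut d} (hw : IsWeaklyBranchAction ρ) (v : Vertex d) :
    ∃ g ∈ ristAct ρ v, g ≠ 1 := by
  by_contra! H
  have hbot : ristLevel ρ.range v.length = ⊥ := by
    refine iSup_eq_bot.2 fun v' => (Subgroup.eq_bot_iff_forall _).2 ?_
    rintro _ ⟨⟨h, rfl⟩, hh⟩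
    obtain ⟨_, ⟨g, rfl⟩, hg⟩ := hw.2.1 v'.1 v v'.2
    have h1 := conj_mem_ristAct (ρ := ρ) (mem_ristAct.2 hh) g
    rw [hg] at h1
    have h2 := H _ h1
    rw [conj_eq_one_iff] at h2
    rw [h2, map_one]
  have := hw.2.2 v.length
  rw [hbot] at this
  exact not_finite (⊥ : Subgroup (TreeAut d))

theorem exists_ristAct_inf_ne_one [Nontrivial (Fin d)] {ρ : Γ →* TreeAut d}
    (hw : IsWeaklyBranchAction ρ) (M : Subgroup Γ) [M.FiniteIndex] (v : Vertex d) :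
    ∃ g ∈ ristAct ρ v ⊓ M, g ≠ 1 := by
  obtain ⟨a, b, hab⟩ := exists_pair_ne (Fin d)
  -- The vertices `v aᵏ b` are infinitely many and pairwise incomparable. Two of the chosen elements
  -- share a coset of `M`, and their quotient is nontrivial because incomparable rigid stabilizers
  -- meet trivially.
  choose g hg hg1 using fun k : ℕ => exists_ristAct_ne_one hw (v ++ (List.replicate k a ++ [b]))
  obtain ⟨i, j, hij, hgij⟩ := Finite.exists_ne_map_eq_of_infinite fun k => (g k : Γ ⧸ M)
  have key : ∀ i j : ℕ, i < j → ∀ x, (v ++ (List.replicate i a ++ [b])) <+: x →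
      ¬ (v ++ (List.replicate j a ++ [b])) <+: x := by
    intro i j hij x h1 h2
    have h3 := List.prefix_of_prefix_length_le h1 h2 (by simp; omega)
    rw [List.prefix_append_right_inj] at h3
    have h4 := h3.getElem (i := i) (by simp)
    simp [hij] at h4
    exact hab h4.symm
  refine ⟨(g i)⁻¹ * g j, ⟨Subgroup.mul_mem _ (Subgroup.inv_mem _ ?_) ?_, QuotientGroup.eq.1 hgij⟩, fun h => hg1 i ?_⟩
  · exact ristAct_mono (List.prefix_append _ _) (hg i)
  · exact ristAct_mono (List.prefix_append _ _) (hg j)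
  · have hh : g i = g j := inv_mul_eq_one.1 h
    rcases lt_or_gt_of_ne hij with h | h
    · exact eq_one_of_mem_ristAct hw.1 (key i j h) (hg i) (hh ▸ hg j)
    · exact eq_one_of_mem_ristAct hw.1 (key j i h) (hh ▸ hg j) (hg i)

theorem exists_ristAct_inf_not_commute [Nontrivial (Fin d)] {ρ : Γ →* TreeAut d}
    (hw : IsWeaklyBranchAction ρ) (M : Subgroup Γ) [M.FiniteIndex] (v : Vertex d) :
    ∃ a ∈ ristAct ρ v ⊓ M, ∃ b ∈ ristAct ρ v ⊓ M, a * b ≠ b * a := by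
  obtain ⟨g, hg, hg1⟩ := exists_ristAct_inf_ne_one hw M v
  obtain ⟨u, hu⟩ : ∃ u, (ρ g).1 u ≠ u := by
    by_contra! H
    exact hg1 (hw.1 ((TreeAut.ext_apply H).trans (map_one ρ).symm))
  obtain ⟨h, hh, hh1⟩ := exists_ristAct_inf_ne_one hw M u
  have hvu : v <+: u := by
    by_contra H
    exact hu (mem_ristAct.1 hg.1 u H)
  -- If `h` commuted with `g`, it would be supported both below `u` and below its image under `g`,
  -- which is another vertex of the same level.
  refine ⟨g, hg, h, ⟨ristAct_mono hvu hh.1, hh.2⟩, fun hc => hh1 ?_⟩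
  have h1 := conj_mem_ristAct hh.1 g
  rw [mul_inv_eq_of_eq_mul hc] at h1
  exact eq_one_of_mem_ristAct hw.1
    (fun x h1 h2 => hu (List.eq_of_common_extension h1 h2 (TreeAut.length_apply _ _))) h1 hh.1

/-- Write `[a, r] = a · (r a⁻¹ r⁻¹)`. The second factor is supported below the image of `u` under
`r`, away from `u`, and so commutes with `b`: thus `[[a, r], b] = [a, b]`. -/
theorem commutator_eq_of_moves {ρ : Γ →* TreeAut d} (hρ : Function.Injective ρ) {u : Vertex d}
    {r a b : Γ} (hr : (ρ r).1 u ≠ u) (ha : a ∈ ristAct ρ u) (hb : b ∈ ristAct ρ u) :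
    a * r * a⁻¹ * r⁻¹ * b * (a * r * a⁻¹ * r⁻¹)⁻¹ * b⁻¹ = a * b * a⁻¹ * b⁻¹ := by
  have h1 := commute_of_mem_ristAct hρ
    (fun x h1 h2 => hr (List.eq_of_common_extension h1 h2 (TreeAut.length_apply _ _)))
    (conj_mem_ristAct (inv_mem ha) r) hb
  calc a * r * a⁻¹ * r⁻¹ * b * (a * r * a⁻¹ * r⁻¹)⁻¹ * b⁻¹
      = a * ((r * a⁻¹ * r⁻¹) * b) * (r * a⁻¹ * r⁻¹)⁻¹ * a⁻¹ * b⁻¹ := by group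
    _ = a * b * a⁻¹ * b⁻¹ := by rw [h1]; group

/-- If `a` and `b` normalize `R` then `[[a, r], b]` lies in `R`, and it equals `[a, b]`. It will be
used with `R` a rigid stabilizer of the other action. -/
theorem commutator_mem_of_moves {ρ : Γ →* TreeAut d} (hρ : Function.Injective ρ) {u : Vertex d}
    {R : Subgroup Γ} {r a b : Γ} (hrR : r ∈ R) (hr : (ρ r).1 u ≠ u)
    (ha : a ∈ ristAct ρ u) (hb : b ∈ ristAct ρ u)
    (haR : ∀ x ∈ R, a * x * a⁻¹ ∈ R) (hbR : ∀ x ∈ R, b * x * b⁻¹ ∈ R) :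
    a * b * a⁻¹ * b⁻¹ ∈ R := by
  rw [← commutator_eq_of_moves hρ hr ha hb]
  have h1 : a * r * a⁻¹ * r⁻¹ ∈ R := mul_mem (haR r hrR) (inv_mem hrR)
  have h2 : a * r * a⁻¹ * r⁻¹ * b * (a * r * a⁻¹ * r⁻¹)⁻¹ * b⁻¹ =
      a * r * a⁻¹ * r⁻¹ * (b * (a * r * a⁻¹ * r⁻¹)⁻¹ * b⁻¹) := by group
  rw [h2]
  exact mul_mem h1 (hbR _ (inv_mem h1))

instance vertexStab_finiteIndex (ρ : Γ →* TreeAut d) (v : Vertex d) :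
    (vertexStab ρ v).FiniteIndex := by
  have : Finite {u : Vertex d // u.length = v.length} :=
    (List.finite_length_eq (Fin d) v.length).to_subtype
  have : Finite (Γ ⧸ vertexStab ρ v) := by
    let f : Γ ⧸ vertexStab ρ v → {u : Vertex d // u.length = v.length} :=
      Quotient.lift (fun g => ⟨(ρ g).1 v, TreeAut.length_apply _ _⟩) (by
        intro a b hab
        have h : a⁻¹ * b ∈ vertexStab ρ v := QuotientGroup.leftRel_apply.1 hab
        rw [mem_vertexStab, map_mul, map_inv, TreeAut.mul_apply, TreeAut.inv_apply_eq] at h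
        exact Subtype.ext h.symm)
    refine Finite.of_injective f ?_
    rintro ⟨a⟩ ⟨b⟩ hab
    refine Quotient.sound (QuotientGroup.leftRel_apply.2 ?_)
    rw [mem_vertexStab, map_mul, map_inv, TreeAut.mul_apply, TreeAut.inv_apply_eq]
    exact (congrArg Subtype.val hab).symm
  exact Subgroup.finiteIndex_of_finite_quotient

/-- In two weakly branch actions of the same group, every vertex stabilizer of the second action
contains a vertex stabilizer of the first. -/
theorem exists_vertexStab_le [Nontrivial (Fin d)] {ρ τ : Γ →* TreeAut d}
    (hρ : IsWeaklyBranchAction ρ) (hτ : IsWeaklyBranchAction τ) (w : Vertex d) :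
    ∃ v, vertexStab ρ v ≤ vertexStab τ w := by
  obtain ⟨r, hr, hr1⟩ := exists_ristAct_ne_one hτ w
  obtain ⟨v, hv⟩ : ∃ v, (ρ r).1 v ≠ v := by
    by_contra! H
    exact hr1 (hρ.1 ((TreeAut.ext_apply H).trans (map_one ρ).symm))
  -- Any `v` moved by a nontrivial `r` in the `τ`-rigid stabilizer of `w` works. If `g` fixes `v`
  -- but moves `w` to `w'`, then `g r g⁻¹` also moves `v` and is `τ`-supported below `w'`.
  refine ⟨v, fun g hg => ?_⟩
  by_contra hne
  set w' := (τ g).1 w with hw'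
  have hr' := conj_mem_ristAct hr g
  have hv' : (ρ (g * r * g⁻¹)).1 v ≠ v := by
    intro h
    rw [map_mul, TreeAut.mul_apply, mem_vertexStab.1 (inv_mem hg), map_mul, TreeAut.mul_apply] at h
    exact hv ((ρ g).1.injective (h.trans (mem_vertexStab.1 hg).symm))
  -- Fixing `w` and `w'` under `τ` makes `a` and `b` normalize both rigid stabilizers. Their
  -- commutator then lies in both, hence is trivial.
  obtain ⟨a, ha, b, hb, hab⟩ :=
    exists_ristAct_inf_not_commute hρ (vertexStab τ w ⊓ vertexStab τ w') v
  have hn : ∀ z : Vertex d, ∀ c ∈ vertexStab τ z, ∀ x ∈ ristAct τ z, c * x * c⁻¹ ∈ ristAct τ z := by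
    intro z c hc x hx
    have := conj_mem_ristAct hx c
    rwa [mem_vertexStab.1 hc] at this
  have h1 := commutator_mem_of_moves hρ.1 hr hv ha.1 hb.1 (hn w a ha.2.1) (hn w b hb.2.1)
  have h2 := commutator_mem_of_moves hρ.1 hr' hv' ha.1 hb.1 (hn w' a ha.2.2) (hn w' b hb.2.2)
  have h3 := eq_one_of_mem_ristAct hτ.1
    (fun x h1 h2 => hne (List.eq_of_common_extension h2 h1 (TreeAut.length_apply _ _))) h1 h2
  refine hab ?_
  rwa [mul_inv_eq_one, mul_inv_eq_iff_eq_mul] at h3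

end Actions

/-! ### Indices of vertex stabilizers, level stabilizers and labels. -/

section Level

variable {d : ℕ} {Γ : Type*} [Group Γ]

theorem natCard_level (d n : ℕ) : Nat.card {u : Vertex d // u.length = n} = d ^ n := by
  have h : Fintype.card (List.Vector (Fin d) n) = d ^ n := by rw [card_vector, Fintype.card_fin]
  rw [← h, ← Nat.card_eq_fintype_card]
  rfl

instance finite_level (d n : ℕ) : Finite {u : Vertex d // u.length = n} :=
  (List.finite_length_eq (Fin d) n).to_subtype

theorem vertexStab_index {ρ : Γ →* TreeAut d} (hρ : IsLevelTransitive ρ.range) (v : Vertex d) :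
    (vertexStab ρ v).index = d ^ v.length := by
  rw [← natCard_level]
  let f : Γ ⧸ vertexStab ρ v → {u : Vertex d // u.length = v.length} :=
    Quotient.lift (fun g => ⟨(ρ g).1 v, TreeAut.length_apply _ _⟩) (by
      intro a b hab
      have h : a⁻¹ * b ∈ vertexStab ρ v := QuotientGroup.leftRel_apply.1 hab
      rw [mem_vertexStab, map_mul, map_inv, TreeAut.mul_apply, TreeAut.inv_apply_eq] at h
      exact Subtype.ext h.symm)
  refine Nat.card_eq_of_bijective f ⟨?_, ?_⟩
  · rintro ⟨a⟩ ⟨b⟩ hab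
    refine Quotient.sound (QuotientGroup.leftRel_apply.2 ?_)
    rw [mem_vertexStab, map_mul, map_inv, TreeAut.mul_apply, TreeAut.inv_apply_eq]
    exact (congrArg Subtype.val hab).symm
  · rintro ⟨u, hu⟩
    obtain ⟨_, ⟨g, rfl⟩, hg⟩ := hρ v u hu.symm
    exact ⟨(g : Γ ⧸ vertexStab ρ v), Subtype.ext hg⟩

theorem vertexStab_anti {ρ : Γ →* TreeAut d} {u v : Vertex d} (h : u <+: v) :
    vertexStab ρ v ≤ vertexStab ρ u := by
  obtain ⟨w, rfl⟩ := h
  intro g hg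
  rw [mem_vertexStab, TreeAut.sec_spec] at hg
  exact (List.append_inj hg (TreeAut.length_apply _ _)).1

theorem vertexStab_nil (ρ : Γ →* TreeAut d) : vertexStab ρ [] = ⊤ :=
  (Subgroup.eq_top_iff' _).2 fun _ =>
    List.eq_nil_of_length_eq_zero (TreeAut.length_apply _ _)

theorem mem_vertexStab_append {ρ : Γ →* TreeAut d} {u v : Vertex d} {g : Γ}
    (hg : g ∈ vertexStab ρ u) :
    g ∈ vertexStab ρ (u ++ v) ↔ ((ρ g).sec u).1 v = v := by
  rw [mem_vertexStab, TreeAut.sec_spec, mem_vertexStab.1 hg, List.append_cancel_left_eq]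

theorem levelStab_succ_iff {g : TreeAut d} {n : ℕ} (hg : g ∈ levelStab d n) :
    g ∈ levelStab d (n + 1) ↔ ∀ v : Vertex d, v.length = n → g.label v = 1 := by
  constructor
  · intro h v hv
    refine Equiv.ext fun x => ?_
    have h1 := h (v ++ [x]) (by simp [hv])
    rw [TreeAut.label_spec, hg v hv, List.append_cancel_left_eq] at h1
    exact List.singleton_injective h1
  · intro h v hv
    have hne : v ≠ [] := by
      rintro rfl
      simp at hv
    have hl : v.dropLast.length = n := by simp [hv]
    rw [← List.dropLast_append_getLast hne, TreeAut.label_spec, h _ hl, hg _ hl]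
    rfl

theorem mem_levelStab_zero (g : TreeAut d) : g ∈ levelStab d 0 := fun v hv => by
  rw [List.eq_nil_of_length_eq_zero hv]
  exact List.eq_nil_of_length_eq_zero (TreeAut.length_apply _ _)

theorem label_mul_of_mem_levelStab {g h : TreeAut d} {n : ℕ} (hh : h ∈ levelStab d n)
    {v : Vertex d} (hv : v.length = n) : (g * h).label v = g.label v * h.label v := by
  rw [TreeAut.label_mul, hh v hv]

theorem label_pow_of_mem_levelStab {g : TreeAut d} {n : ℕ} (hg : g ∈ levelStab d n)
    {v : Vertex d} (hv : v.length = n) (k : ℕ) : (g ^ k).label v = g.label v ^ k := by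
  induction k with
  | zero => exact TreeAut.label_one v
  | succ k ih => rw [pow_succ, label_mul_of_mem_levelStab hg hv, ih, pow_succ]

instance levelStab_normal (d n : ℕ) : (levelStab d n).Normal where
  conj_mem g hg t v hv := by
    rw [TreeAut.mul_apply, TreeAut.mul_apply,
      hg _ ((TreeAut.length_apply t⁻¹ v).trans hv), TreeAut.apply_inv_self]

instance levelStab_finiteIndex (d n : ℕ) : (levelStab d n).FiniteIndex := by
  have h : levelStab d n =
      ⨅ v : {u : Vertex d // u.length = n}, vertexStab (MonoidHom.id (TreeAut d)) v.1 := by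
    ext g
    simp only [Subgroup.mem_iInf, Subtype.forall]
    rfl
  rw [h]
  exact Subgroup.finiteIndex_iInf fun v => inferInstance

end Level

/-! ### Powers of the `p`-cycle. -/

section Rotation

variable {p : ℕ} [hp : Fact p.Prime]

theorem card_zpowers_finRotate : Nat.card (Subgroup.zpowers (finRotate p)) = p := by
  obtain ⟨k, rfl⟩ := Nat.exists_eq_add_of_le' hp.out.two_le
  rw [Nat.card_zpowers, isCycle_finRotate.orderOf, support_finRotate, Finset.card_univ,
    Fintype.card_fin]

theorem pow_eq_one_of_mem_zpowers_finRotate {c : Equiv.Perm (Fin p)}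
    (hc : c ∈ Subgroup.zpowers (finRotate p)) : c ^ p = 1 := by
  have h := pow_card_eq_one' (x := (⟨c, hc⟩ : Subgroup.zpowers (finRotate p)))
  rw [card_zpowers_finRotate] at h
  exact congrArg Subtype.val h

/-- The cycle moves every letter, so a power of it with a fixed point is trivial. Hence an element
of `W_p` that fixes a vertex and one child of it fixes all its children. -/
theorem eq_one_of_mem_zpowers_finRotate {c : Equiv.Perm (Fin p)}
    (hc : c ∈ Subgroup.zpowers (finRotate p)) {x : Fin p} (hx : c x = x) : c = 1 := by
  obtain ⟨n, rfl⟩ := mem_powers_iff_mem_zpowers.2 hc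
  obtain ⟨k, rfl⟩ := Nat.exists_eq_add_of_le' hp.out.two_le
  refine (isCycle_finRotate.pow_eq_one_iff' (x := x) ?_).2 hx
  rw [← Equiv.Perm.mem_support, support_finRotate]
  exact Finset.mem_univ x

/-- On `St(n)` the labels of level `n` multiply, and they have order dividing `p`; each `p`-th power
therefore gains a level. -/
theorem pow_pow_mem_levelStab {g : TreeAut p} (hg : g ∈ padicAut p) (n : ℕ) :
    g ^ p ^ n ∈ levelStab p n := by
  induction n with
  | zero => exact mem_levelStab_zero _
  | succ n ih =>
    rw [pow_succ, pow_mul]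
    refine (levelStab_succ_iff (pow_mem ih p)).2 fun v hv => ?_
    rw [label_pow_of_mem_levelStab ih hv]
    exact pow_eq_one_of_mem_zpowers_finRotate (pow_mem hg _ v)

end Rotation

/-! ### Subgroups of index `p`. -/

theorem Subgroup.normal_of_index_eq_prime {p : ℕ} [hp : Fact p.Prime] {Γ : Type*} [Group Γ]
    {N K : Subgroup Γ} [N.Normal] [N.FiniteIndex] (hN : IsPGroup p (Γ ⧸ N)) (hNK : N ≤ K)
    (hK : K.index = p) : K.Normal := by
  have hker : (QuotientGroup.mk' N).ker ≤ K := by rwa [QuotientGroup.ker_mk']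
  have hsurj := QuotientGroup.mk'_surjective N
  have hidx : (K.map (QuotientGroup.mk' N)).index = p := by
    rw [Subgroup.index_map_eq _ hsurj hker, hK]
  have : (K.map (QuotientGroup.mk' N)).Normal := by
    -- In a finite `p`-group, `p` is the smallest prime divisor of the order.
    apply Subgroup.normal_of_index_eq_minFac_card
    obtain ⟨k, hk⟩ := IsPGroup.iff_card.1 hN
    rw [hidx, hk]
    have hk0 : k ≠ 0 := by
      rintro rfl
      have h := (K.map (QuotientGroup.mk' N)).index_dvd_card
      rw [hidx, hk, pow_zero, Nat.dvd_one] at h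
      exact hp.out.ne_one h
    rw [hp.out.pow_minFac hk0]
  rw [← Subgroup.comap_map_eq_self hker]
  exact this.comap _

/-- Distinct subgroups of prime index `p` generate the whole group, and `|S : S ∩ K| = |SK : K|` for
normal `K`. -/
theorem Subgroup.relIndex_of_ne_of_index_eq_prime {p : ℕ} (hp : p.Prime) {Γ : Type*} [Group Γ]
    {K S : Subgroup Γ} [K.Normal] (hK : K.index = p) (hS : S.index = p) (hne : K ≠ S) :
    K.relIndex S = p := by
  have htop : S ⊔ K = ⊤ := by
    rw [← Subgroup.index_eq_one]
    have hdvd : (S ⊔ K).index ∣ p := hK ▸ Subgroup.index_dvd_of_le le_sup_right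
    refine ((Nat.dvd_prime hp).1 hdvd).resolve_right fun h => hne ?_
    have h1 := Subgroup.relIndex_mul_index (le_sup_right : K ≤ S ⊔ K)
    have h2 := Subgroup.relIndex_mul_index (le_sup_left : S ≤ S ⊔ K)
    rw [h, hK] at h1
    rw [h, hS] at h2
    have h3 := Subgroup.relIndex_eq_one.1 (Nat.eq_of_mul_eq_mul_right hp.pos
      (h1.trans (one_mul p).symm))
    have h4 := Subgroup.relIndex_eq_one.1 (Nat.eq_of_mul_eq_mul_right hp.pos
      (h2.trans (one_mul p).symm))
    exact le_antisymm (le_sup_right.trans h4) (le_sup_left.trans h3)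
  rw [← Subgroup.relIndex_sup_right, htop, Subgroup.relIndex_top_right, hK]

/-! ### Passing to sections in fractal groups. -/

section Fractal

variable {d : ℕ} {G : Subgroup (TreeAut d)}

/-- The section of an element of a self-similar group. -/
def IsSelfSimilar.section (hG : IsSelfSimilar G) (u : Vertex d) (g : G) : G :=
  ⟨g.1.sec u, hG g g.2 u⟩

/-- The section homomorphism of a vertex stabilizer in a self-similar group. -/
def IsSelfSimilar.sectionHom (hG : IsSelfSimilar G) (u : Vertex d) :
    vertexStab G.subtype u →* G where
  toFun g := hG.section u g
  map_one' := Subtype.ext (TreeAut.sec_one u)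
  map_mul' g h := Subtype.ext <| by
    change (g.1.1 * h.1.1).sec u = g.1.1.sec u * h.1.1.sec u
    rw [TreeAut.sec_mul]
    congr 2
    exact h.2

/-- Take for `K'` the image of `K ∩ st(u)` under the section map at `u`. This map is onto `G` by
fractality, and its kernel fixes `u ++ v`, hence lies in `K`; so index and membership are preserved.
-/
theorem IsFractal.exists_section_subgroup (hG : IsFractal G) (u v : Vertex d) (K : Subgroup G)
    (hv : vertexStab G.subtype (u ++ v) ≤ K) :
    ∃ K' : Subgroup G, K'.index = K.relIndex (vertexStab G.subtype u) ∧
      vertexStab G.subtype v ≤ K' ∧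
      ∀ g ∈ vertexStab G.subtype u, g ∈ K ↔ hG.1.section u g ∈ K' := by
  have hsurj : Function.Surjective (hG.1.sectionHom u) := by
    intro h
    obtain ⟨g, hg, hgu, hgs⟩ := hG.2.2 u h h.2
    exact ⟨⟨⟨g, hg⟩, hgu⟩, Subtype.ext hgs⟩
  have hker : (hG.1.sectionHom u).ker ≤ K.subgroupOf (vertexStab G.subtype u) := by
    intro g hg
    refine Subgroup.mem_subgroupOf.2 (hv ((mem_vertexStab_append g.2).2 ?_))
    have h1 : g.1.1.sec u = 1 := congrArg Subtype.val (MonoidHom.mem_ker.1 hg)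
    exact congrArg (fun k : TreeAut d => k.1 v) h1
  refine ⟨(K.subgroupOf (vertexStab G.subtype u)).map (hG.1.sectionHom u),
    Subgroup.index_map_eq _ hsurj hker, fun h hh => ?_, fun g hg => ?_⟩
  · obtain ⟨g, rfl⟩ := hsurj h
    exact Subgroup.mem_map_of_mem _
      (Subgroup.mem_subgroupOf.2 (hv ((mem_vertexStab_append g.2).2 hh)))
  · have h1 : (⟨g, hg⟩ : vertexStab G.subtype u) ∈ K.subgroupOf (vertexStab G.subtype u) ↔
        hG.1.sectionHom u ⟨g, hg⟩ ∈
          (K.subgroupOf (vertexStab G.subtype u)).map (hG.1.sectionHom u) := by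
      rw [← Subgroup.mem_comap, Subgroup.comap_map_eq_self hker]
    exact Subgroup.mem_subgroupOf.symm.trans h1

theorem label_conj_eq_one_iff {g : TreeAut d} (hg : g ∈ levelStab d 1) (t : TreeAut d)
    (x : Fin d) : (t⁻¹ * g * t).label [x] = 1 ↔ g.label (t.1 [x]) = 1 := by
  have h1 := TreeAut.label_mul t⁻¹ t [x]
  rw [inv_mul_cancel, TreeAut.label_one] at h1
  have hgt : g.1 (t.1 [x]) = t.1 [x] := hg _ (TreeAut.length_apply _ _)
  rw [TreeAut.label_mul, TreeAut.label_mul, hgt, eq_inv_of_mul_eq_one_left h1.symm]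
  constructor
  · intro h
    have h2 : (t.label [x])⁻¹ * g.label (t.1 [x]) * (t.label [x])⁻¹⁻¹ = 1 := by rwa [inv_inv]
    exact conj_eq_one_iff.1 h2
  · intro h
    rw [h, mul_one, inv_mul_cancel]

/-- In the first level stabilizer of `G`, the triviality of the label at one vertex of the first
level forces the triviality of all labels on the first level. -/
def FirstLevelLabelsTied (G : Subgroup (TreeAut d)) : Prop :=
  ∀ g ∈ G, g ∈ levelStab d 1 → ∀ x y : Fin d, g.label [x] = 1 → g.label [y] = 1

end Fractal

/-! ### Subgroups of `G` above a vertex stabilizer. -/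

section PAdic

variable {p : ℕ} [hp : Fact p.Prime] {G : Subgroup (TreeAut p)}

theorem isPGroup_quotient_levelStab (hGW : G ≤ padicAut p) (n : ℕ) :
    IsPGroup p (G ⧸ (levelStab p n).subgroupOf G) := by
  rintro ⟨g⟩
  refine ⟨n, ?_⟩
  change ((g : G) : G ⧸ (levelStab p n).subgroupOf G) ^ p ^ n = 1
  rw [← QuotientGroup.mk_pow, QuotientGroup.eq_one_iff, Subgroup.mem_subgroupOf]
  exact pow_pow_mem_levelStab (hGW g.2) n

theorem mem_vertexStab_snoc_iff_label (hGW : G ≤ padicAut p) {u : Vertex p} {g : G}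
    (hg : g ∈ vertexStab G.subtype u) (x : Fin p) :
    g ∈ vertexStab G.subtype (u ++ [x]) ↔ g.1.label u = 1 := by
  have hgu : g.1.1 u = u := hg
  rw [mem_vertexStab, Subgroup.subtype_apply, TreeAut.label_spec, hgu,
    List.append_cancel_left_eq]
  constructor
  · intro h
    exact eq_one_of_mem_zpowers_finRotate (hGW g.2 u) (List.singleton_injective h)
  · intro h
    rw [h]
    rfl

theorem mem_vertexStab_singleton_iff (hGW : G ≤ padicAut p) {g : G} (x : Fin p) :
    g ∈ vertexStab G.subtype [x] ↔ g.1 ∈ levelStab p 1 := by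
  have h0 : g ∈ vertexStab G.subtype [] := by
    rw [vertexStab_nil]
    trivial
  rw [levelStab_succ_iff (mem_levelStab_zero _)]
  refine (mem_vertexStab_snoc_iff_label hGW h0 x).trans ⟨fun h v hv => ?_, fun h => h [] rfl⟩
  rwa [List.eq_nil_of_length_eq_zero hv]

theorem vertexStab_singleton_index {p : ℕ} {G : Subgroup (TreeAut p)} (hG : IsLevelTransitive G) (x : Fin p) :
    (vertexStab G.subtype [x]).index = p := by
  rw [vertexStab_index (by rwa [Subgroup.range_subtype])]
  exact pow_one p

/-- A subgroup of index `p` that contains a vertex stabilizer is the first level stabilizer. -/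
theorem IsFractal.eq_vertexStab_of_index_eq_prime (hGW : G ≤ padicAut p) (hG : IsFractal G)
    (hT : ¬ FirstLevelLabelsTied G) (v : Vertex p) : ∀ K : Subgroup G, K.index = p →
      vertexStab G.subtype v ≤ K → ∀ y : Fin p, K = vertexStab G.subtype [y] := by
  induction v with
  | nil =>
    intro K hK hv
    rw [vertexStab_nil, top_le_iff] at hv
    rw [hv, Subgroup.index_top] at hK
    exact absurd hK.symm hp.out.ne_one
  | cons x v ih =>
    intro K hK hv y
    by_contra hne
    have hS : vertexStab G.subtype [y] = vertexStab G.subtype [x] := by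
      ext g
      rw [mem_vertexStab_singleton_iff hGW, mem_vertexStab_singleton_iff hGW]
    rw [hS] at hne
    have hle : (levelStab p (v.length + 1)).subgroupOf G ≤ K := fun g hg => hv (hg _ rfl)
    -- `K` contains a level stabilizer, modulo which `G` is a finite `p`-group.
    have hKn : K.Normal :=
      Subgroup.normal_of_index_eq_prime (isPGroup_quotient_levelStab hGW _) hle hK
    have hrel := Subgroup.relIndex_of_ne_of_index_eq_prime hp.out hK
      (vertexStab_singleton_index hG.2.1 x) hne
    obtain ⟨K', hK', hvK', hmem⟩ := hG.exists_section_subgroup [x] v K hv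
    -- By induction the section of `K` at `x` is `St_G(1)`, so on `St_G(1)` membership in `K` means
    -- a trivial label at `x`.
    have hKx : ∀ g : G, g.1 ∈ levelStab p 1 → (g ∈ K ↔ g.1.label [x] = 1) := by
      intro g hg
      have hgx := (mem_vertexStab_singleton_iff hGW x).2 hg
      rw [hmem g hgx, ih K' (hK'.trans hrel) hvK' x,
        ← mem_vertexStab_snoc_iff_label hGW hgx x, mem_vertexStab_append hgx]
      rfl
    -- Normality of `K` and transitivity on the first level move the criterion from `x` to every
    -- letter. This ties the labels.
    have hKy : ∀ g : G, g.1 ∈ levelStab p 1 → ∀ y : Fin p, g ∈ K ↔ g.1.label [y] = 1 := by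
      intro g hg y
      obtain ⟨t, ht, htx⟩ := hG.2.1 [x] [y] rfl
      have h1 : t⁻¹ * g.1 * t ∈ levelStab p 1 := by
        have := (levelStab_normal p 1).conj_mem g.1 hg t⁻¹
        rwa [inv_inv] at this
      let t' : G := ⟨t, ht⟩
      rw [← htx, ← label_conj_eq_one_iff hg t x]
      have h2 := hKx (t'⁻¹ * g * t') h1
      refine Iff.trans ⟨fun h => ?_, fun h => ?_⟩ h2
      · have h3 := hKn.conj_mem g h t'⁻¹
        rwa [inv_inv] at h3
      · have h3 := hKn.conj_mem _ h t'
        rwa [mul_assoc, mul_assoc, mul_assoc, mul_inv_cancel, mul_one, mul_inv_cancel_left] at h3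
    refine hT fun g hg hg1 a b hab => ?_
    exact (hKy ⟨g, hg⟩ hg1 b).1 ((hKy ⟨g, hg⟩ hg1 a).2 hab)

/-- A chain of subgroups of successive indices `p` whose last member contains a vertex stabilizer
consists of vertex stabilizers. -/
theorem IsFractal.chain_eq_vertexStab (hGW : G ≤ padicAut p) (hG : IsFractal G)
    (hT : ¬ FirstLevelLabelsTied G) {H : ℕ → Subgroup G} (h0 : H 0 = ⊤)
    (hle : ∀ n, H (n + 1) ≤ H n) (hidx : ∀ n, (H (n + 1)).relIndex (H n) = p) (v : Vertex p)
    (n : ℕ) (hv : vertexStab G.subtype v ≤ H n) :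
    n ≤ v.length ∧ H n = vertexStab G.subtype (v.take n) := by
  induction n with
  | zero => exact ⟨Nat.zero_le _, by rw [h0, List.take_zero, vertexStab_nil]⟩
  | succ n ih =>
    obtain ⟨hn, hHn⟩ := ih (hv.trans (hle n))
    have hvv : vertexStab G.subtype (v.take n ++ v.drop n) ≤ H (n + 1) := by
      rwa [List.take_append_drop]
    obtain ⟨K', hK', hvK', hmem⟩ := hG.exists_section_subgroup _ _ _ hvv
    rw [← hHn, hidx] at hK'
    -- If `v` were already exhausted, `K'` would contain the stabilizer of the root, which is all of
    -- `G`.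
    have hlt : n < v.length := by
      by_contra hge
      rw [List.drop_eq_nil_of_le (not_lt.1 hge), vertexStab_nil, top_le_iff] at hvK'
      rw [hvK', Subgroup.index_top] at hK'
      exact hp.out.ne_one hK'.symm
    refine ⟨hlt, ?_⟩
    have hK'' := hG.eq_vertexStab_of_index_eq_prime hGW hT _ K' hK' hvK' v[n]
    rw [List.take_succ_eq_append_getElem hlt]
    ext g
    have key : ∀ hg : g ∈ vertexStab G.subtype (v.take n),
        (g ∈ H (n + 1) ↔ g ∈ vertexStab G.subtype (v.take n ++ [v[n]])) := by
      intro hg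
      rw [hmem g hg, hK'', mem_vertexStab_append hg]
      rfl
    constructor
    · intro hg
      exact (key (hHn ▸ hle n hg)).1 hg
    · intro hg
      exact (key (vertexStab_anti (List.prefix_append _ _) hg)).2 hg

end PAdic

/-! ### Conjugating actions through the stabilizers of a ray. -/

section Conjugacy

variable {d : ℕ} {Γ : Type*} [Group Γ]

/-- By transitivity every vertex is a translate of some `w n`, and the inclusion of stabilizers
makes `τ(g) w n ↦ ρ(g) v n` well defined. -/
theorem exists_equivariant_map {ρ τ : Γ →* TreeAut d} (hτ : IsLevelTransitive τ.range)
    {v w : ℕ → Vertex d} (hw : ∀ n, (w n).length = n)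
    (hst : ∀ n, vertexStab τ (w n) ≤ vertexStab ρ (v n)) :
    ∃ F : Vertex d → Vertex d, ∀ g n, F ((τ g).1 (w n)) = (ρ g).1 (v n) := by
  have hex : ∀ u : Vertex d, ∃ g : Γ, (τ g).1 (w u.length) = u := by
    intro u
    obtain ⟨_, ⟨g, rfl⟩, hg⟩ := hτ (w u.length) u (hw _)
    exact ⟨g, hg⟩
  choose γ hγ using hex
  refine ⟨fun u => (ρ (γ u)).1 (v u.length), fun g n => ?_⟩
  have hlen : ((τ g).1 (w n)).length = n := (TreeAut.length_apply _ _).trans (hw n)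
  have h1 := hγ ((τ g).1 (w n))
  simp only [hlen] at h1 ⊢
  have h2 : g⁻¹ * γ ((τ g).1 (w n)) ∈ vertexStab τ (w n) := by
    rw [mem_vertexStab, map_mul, map_inv, TreeAut.mul_apply, TreeAut.inv_apply_eq]
    exact h1
  have h3 := hst n h2
  rwa [mem_vertexStab, map_mul, map_inv, TreeAut.mul_apply, TreeAut.inv_apply_eq] at h3

theorem exists_apply_ray_eq {τ : Γ →* TreeAut d} (hτ : IsLevelTransitive τ.range)
    {w : ℕ → Vertex d} (hw : ∀ n, (w n).length = n) (x : Vertex d) :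
    ∃ g n, (τ g).1 (w n) = x := by
  obtain ⟨_, ⟨g, rfl⟩, hg⟩ := hτ (w x.length) x (hw _)
  exact ⟨g, _, hg⟩

theorem length_and_prefix_of_equivariant_map {ρ τ : Γ →* TreeAut d}
    (hτ : IsLevelTransitive τ.range) {v w : ℕ → Vertex d} (hv : ∀ n, (v n).length = n)
    (hw : ∀ n, (w n).length = n) (hvm : ∀ m n, m ≤ n → v m <+: v n)
    (hwm : ∀ m n, m ≤ n → w m <+: w n) {F : Vertex d → Vertex d}
    (hF : ∀ g n, F ((τ g).1 (w n)) = (ρ g).1 (v n)) :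
    (∀ x, (F x).length = x.length) ∧ ∀ x y, x <+: y → F x <+: F y := by
  constructor
  · intro x
    obtain ⟨g, n, rfl⟩ := exists_apply_ray_eq hτ hw x
    rw [hF, TreeAut.length_apply, TreeAut.length_apply, hv, hw]
  · intro x y hxy
    obtain ⟨g, n, rfl⟩ := exists_apply_ray_eq hτ hw y
    have hle : x.length ≤ n := by
      simpa only [TreeAut.length_apply, hw] using hxy.length_le
    have hx : (τ g).1 (w x.length) = x :=
      List.eq_of_common_extension (((τ g).2.2 _ _).2 (hwm _ _ hle)) hxy
        ((TreeAut.length_apply _ _).trans (hw _))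
    rw [← hx, hF, hF, (ρ g).2.2]
    exact hvm _ _ hle

/-- Two level-transitive actions with rays that have the same vertex stabilizers are conjugate. -/
theorem exists_conj_of_rays {ρ τ : Γ →* TreeAut d} (hρ : IsLevelTransitive ρ.range)
    (hτ : IsLevelTransitive τ.range) {v w : ℕ → Vertex d}
    (hv : ∀ n, (v n).length = n) (hw : ∀ n, (w n).length = n)
    (hvm : ∀ m n, m ≤ n → v m <+: v n) (hwm : ∀ m n, m ≤ n → w m <+: w n)
    (hst : ∀ n, vertexStab τ (w n) = vertexStab ρ (v n)) :
    ∃ f : TreeAut d, ∀ g, f * τ g = ρ g * f := by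
  obtain ⟨F, hF⟩ := exists_equivariant_map (ρ := ρ) hτ hw fun n => (hst n).le
  obtain ⟨F', hF'⟩ := exists_equivariant_map (ρ := τ) hρ hv fun n => (hst n).ge
  obtain ⟨hl, hp⟩ :=
    length_and_prefix_of_equivariant_map hτ hv hw hvm hwm hF
  obtain ⟨-, hp'⟩ :=
    length_and_prefix_of_equivariant_map hρ hw hv hwm hvm hF'
  have h1 : ∀ x, F' (F x) = x := by
    intro x
    obtain ⟨g, n, rfl⟩ := exists_apply_ray_eq hτ hw x
    rw [hF, hF']
  have h2 : ∀ x, F (F' x) = x := by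
    intro x
    obtain ⟨g, n, rfl⟩ := exists_apply_ray_eq hρ hv x
    rw [hF', hF]
  refine ⟨⟨⟨F, F', h1, h2⟩, hl, fun x y => ⟨fun h => ?_, hp x y⟩⟩, fun g => ?_⟩
  · have h3 := hp' _ _ h
    change F' (F x) <+: F' (F y) at h3
    rwa [h1, h1] at h3
  · refine TreeAut.ext_apply fun x => ?_
    obtain ⟨k, n, rfl⟩ := exists_apply_ray_eq hτ hw x
    change F ((τ g).1 ((τ k).1 _)) = (ρ g).1 (F ((τ k).1 _))
    rw [hF, ← TreeAut.mul_apply, ← map_mul, hF, map_mul, TreeAut.mul_apply]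

end Conjugacy

/-! ### Rigidity of untied groups. -/

section PAdic

variable {p : ℕ} [hp : Fact p.Prime] {G : Subgroup (TreeAut p)}

/-- Different vertices may have the same stabilizer, so the choices for different `n` need not be
compatible. A compactness (König) argument on the finite sets of admissible vertices yields one ray.
-/
theorem exists_ray_of_stabilizers {p : ℕ} {G : Subgroup (TreeAut p)} {H : ℕ → Subgroup G}
    (h : ∀ n, ∃ v : Vertex p, v.length = n ∧ ∀ m ≤ n, H m = vertexStab G.subtype (v.take m)) :
    ∃ v : ℕ → Vertex p, (∀ n, (v n).length = n) ∧ (∀ m n, m ≤ n → v m <+: v n) ∧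
      ∀ n, H n = vertexStab G.subtype (v n) := by
  let α : ℕ → Type := fun n =>
    {v : Vertex p // v.length = n ∧ ∀ m ≤ n, H m = vertexStab G.subtype (v.take m)}
  have hne : ∀ n, Nonempty (α n) := fun n => ⟨⟨_, (h n).choose_spec⟩⟩
  have hfin : ∀ n, Finite (α n) := fun n =>
    Set.Finite.to_subtype ((List.finite_length_eq (Fin p) n).subset fun v hv => hv.1)
  let π : {i j : ℕ} → i ≤ j → α j → α i := fun {i j} hij a => ⟨a.1.take i, by
    refine ⟨by rw [List.length_take, a.2.1, min_eq_left hij], fun m hm => ?_⟩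
    rw [List.take_take, min_eq_left hm]
    exact a.2.2 m (hm.trans hij)⟩
  obtain ⟨f, hf⟩ := exists_seq_forall_proj_of_forall_finite π
    (fun i a => Subtype.ext (List.take_of_length_le a.2.1.le))
    (fun i j k hij hjk a => Subtype.ext (by
      change (a.1.take j).take i = a.1.take i
      rw [List.take_take, min_eq_left hij]))
    (fun i a => Set.toFinite _)
  refine ⟨fun n => (f n).1, fun n => (f n).2.1, fun m n hmn => ?_, fun n => ?_⟩
  · change (f m).1 <+: (f n).1
    rw [← hf hmn]
    exact List.take_prefix _ _
  · rw [(f n).2.2 n le_rfl, List.take_of_length_le (f n).2.1.le]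

/-- Unless the first level labels are tied, every weakly branch action of a fractal weakly branch
group of `p`-adic automorphisms is conjugate to the given action. -/
theorem IsFractal.exists_conj (hGW : G ≤ padicAut p) (hG : IsFractal G)
    (hι : IsWeaklyBranchAction G.subtype) (hT : ¬ FirstLevelLabelsTied G)
    {τ : G →* TreeAut p} (hτ : IsWeaklyBranchAction τ) :
    ∃ f : TreeAut p, ∀ g, f * τ g = G.subtype g * f := by
  have : Nontrivial (Fin p) := Fin.nontrivial_iff_two_le.2 hp.out.two_le
  let w : ℕ → Vertex p := fun n => List.replicate n ⟨0, hp.out.pos⟩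
  have hw : ∀ n, (w n).length = n := fun n => List.length_replicate
  have hwm : ∀ m n, m ≤ n → w m <+: w n := by
    intro m n hmn
    obtain ⟨k, rfl⟩ := Nat.exists_eq_add_of_le hmn
    simp only [w, List.replicate_add]
    exact List.prefix_append _ _
  have hle : ∀ n, vertexStab τ (w (n + 1)) ≤ vertexStab τ (w n) := fun n =>
    vertexStab_anti (hwm _ _ n.le_succ)
  have hidx : ∀ n, (vertexStab τ (w (n + 1))).relIndex (vertexStab τ (w n)) = p := by
    intro n
    have h1 := Subgroup.relIndex_mul_index (hle n)
    rw [vertexStab_index hτ.2.1, vertexStab_index hτ.2.1, hw, hw, pow_succ'] at h1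
    exact Nat.eq_of_mul_eq_mul_right (pow_pos hp.out.pos n) h1
  have hle' : ∀ m n, m ≤ n → vertexStab τ (w n) ≤ vertexStab τ (w m) := fun m n hmn =>
    vertexStab_anti (hwm _ _ hmn)
  obtain ⟨v, hv, hvm, hst⟩ := exists_ray_of_stabilizers (H := fun n => vertexStab τ (w n)) (by
    intro n
    obtain ⟨v, hv⟩ := exists_vertexStab_le hι hτ (w n)
    have hchain : ∀ m ≤ n, m ≤ v.length ∧
        vertexStab τ (w m) = vertexStab G.subtype (v.take m) := fun m hm =>
      hG.chain_eq_vertexStab (H := fun n => vertexStab τ (w n)) hGW hT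
        (vertexStab_nil τ) hle hidx v m (hv.trans (hle' m n hm))
    refine ⟨v.take n, ?_, fun m hm => ?_⟩
    · rw [List.length_take, min_eq_left (hchain n le_rfl).1]
    · rw [List.take_take, min_eq_left hm]
      exact (hchain m hm).2)
  exact exists_conj_of_rays hι.2.1 hτ.2.1 hv hw hvm hwm hst

theorem isWeaklyBranchAction_subtype {p : ℕ} {G : Subgroup (TreeAut p)} (hbranch : IsWeaklyBranch G) :
    IsWeaklyBranchAction G.subtype :=
  ⟨G.subtype_injective, by rwa [Subgroup.range_subtype]⟩

theorem map_conj_range_eq {Γ : Type*} [Group Γ] {d : ℕ} {ρ τ : Γ →* TreeAut d} {f : TreeAut d}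
    (h : ∀ g, f * ρ g = τ g * f) : ρ.range.map (MulAut.conj f).toMonoidHom = τ.range := by
  rw [← MonoidHom.range_comp]
  congr 1
  ext1 g
  exact mul_inv_eq_of_eq_mul (h g)

/-- Both actions are conjugate to the inclusion of `G`, hence to each other. -/
theorem IsFractal.isTreeRigid (hGW : G ≤ padicAut p) (hG : IsFractal G)
    (hbranch : IsWeaklyBranch G) (hT : ¬ FirstLevelLabelsTied G) : IsTreeRigid p G := by
  have hι := isWeaklyBranchAction_subtype hbranch
  refine ⟨⟨G.subtype, hι⟩, fun ρ τ hρ hτ => ?_⟩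
  obtain ⟨f, hf⟩ := hG.exists_conj hGW hι hT hρ
  obtain ⟨k, hk⟩ := hG.exists_conj hGW hι hT hτ
  refine ⟨k⁻¹ * f, map_conj_range_eq fun g => ?_⟩
  have h1 : k⁻¹ * G.subtype g = τ g * k⁻¹ := by
    rw [inv_mul_eq_iff_eq_mul, ← mul_assoc, hk, mul_inv_cancel_right]
  rw [mul_assoc, hf, ← mul_assoc, h1, mul_assoc]

end PAdic

/-! ### Automorphisms with prescribed labels on one level. -/

section Spread

variable {d : ℕ}

/-- Act on the words of length `n + 1` by letting `c v` move the last letter of `v x`, and leave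
all the other labels trivial. -/
def spread : ℕ → (Vertex d → Equiv.Perm (Fin d)) → Vertex d → Vertex d
  | _, _, [] => []
  | 0, c, x :: v => c [] x :: v
  | n + 1, c, x :: v => x :: spread n (fun u => c (x :: u)) v

theorem length_spread (n : ℕ) (c : Vertex d → Equiv.Perm (Fin d)) (v : Vertex d) :
    (spread n c v).length = v.length := by
  induction v generalizing n c with
  | nil => cases n <;> rfl
  | cons x v ih =>
    cases n with
    | zero => rfl
    | succ n => simp [spread, ih]

theorem spread_inv_spread (n : ℕ) (c : Vertex d → Equiv.Perm (Fin d)) (v : Vertex d) :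
    spread n (fun u => (c u)⁻¹) (spread n c v) = v := by
  induction v generalizing n c with
  | nil => cases n <;> rfl
  | cons x v ih =>
    cases n with
    | zero => simp [spread]
    | succ n => simp [spread, ih]

theorem spread_prefix (n : ℕ) (c : Vertex d → Equiv.Perm (Fin d)) {u v : Vertex d}
    (h : u <+: v) : spread n c u <+: spread n c v := by
  induction v generalizing n c u with
  | nil =>
    rw [List.prefix_nil.1 h]
  | cons x v ih =>
    cases u with
    | nil => cases n <;> exact List.nil_prefix
    | cons y u =>
      obtain ⟨rfl, h'⟩ := List.cons_prefix_cons.1 h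
      cases n with
      | zero => exact List.cons_prefix_cons.2 ⟨rfl, h'⟩
      | succ n => exact List.cons_prefix_cons.2 ⟨rfl, ih _ _ h'⟩

theorem spread_of_length_le {n : ℕ} (c : Vertex d → Equiv.Perm (Fin d)) {v : Vertex d}
    (h : v.length ≤ n) : spread n c v = v := by
  induction v generalizing n c with
  | nil => cases n <;> rfl
  | cons x v ih =>
    cases n with
    | zero => simp at h
    | succ n => exact congrArg _ (ih _ (Nat.le_of_succ_le_succ h))

theorem spread_snoc (n : ℕ) (c : Vertex d → Equiv.Perm (Fin d)) (v : Vertex d) (x : Fin d) :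
    spread n c (v ++ [x]) = spread n c v ++ [(if v.length = n then c v else 1) x] := by
  induction v generalizing n c with
  | nil =>
    cases n with
    | zero => simp [spread]
    | succ n => cases n <;> simp [spread]
  | cons y v ih =>
    cases n with
    | zero => simp [spread]
    | succ n => simp [spread, ih]

/-- The tree automorphism with labels `c` on level `n` and trivial labels elsewhere. -/
def spreadAut (n : ℕ) (c : Vertex d → Equiv.Perm (Fin d)) : TreeAut d :=
  ⟨⟨spread n c, spread n fun u => (c u)⁻¹, spread_inv_spread n c, fun v => by
      simpa using spread_inv_spread n (fun u => (c u)⁻¹) v⟩,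
    length_spread n c, fun u v => ⟨fun h => by
      have h1 := spread_prefix n (fun u => (c u)⁻¹) h
      change spread n _ (spread n c u) <+: spread n _ (spread n c v) at h1
      rwa [spread_inv_spread, spread_inv_spread] at h1, spread_prefix n c⟩⟩

theorem label_spreadAut (n : ℕ) (c : Vertex d → Equiv.Perm (Fin d)) (v : Vertex d) :
    (spreadAut n c).label v = if v.length = n then c v else 1 := by
  refine Equiv.ext fun x => ?_
  have h1 := (spreadAut n c).label_spec v x
  have h2 := h1.symm.trans (spread_snoc n c v x)
  exact List.singleton_injective (List.append_cancel_left h2)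

theorem spreadAut_mem_levelStab (n : ℕ) (c : Vertex d → Equiv.Perm (Fin d)) :
    spreadAut n c ∈ levelStab d n := fun _ hv => spread_of_length_le c hv.le

end Spread

/-! ### Growth of the indices of level stabilizers. -/

section Indices

variable {p : ℕ} [hp : Fact p.Prime]

/-- The labels at a family of vertices of level `n`, on the stabilizer of level `n`. -/
def labelHom {B : Subgroup (TreeAut p)} (hB : B ≤ padicAut p) {n : ℕ} {I : Type*}
    (e : I → {v : Vertex p // v.length = n}) :
    (levelStab p n ⊓ B : Subgroup (TreeAut p)) →* (I → Subgroup.zpowers (finRotate p)) where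
  toFun g i := ⟨g.1.label (e i).1, hB g.2.2 _⟩
  map_one' := funext fun _ => Subtype.ext (TreeAut.label_one _)
  map_mul' _ h := funext fun i => Subtype.ext (label_mul_of_mem_levelStab h.2.1 (e i).2)

theorem relIndex_levelStab_succ {p : ℕ} (B : Subgroup (TreeAut p)) (n : ℕ) :
    (levelStab p (n + 1)).relIndex B =
      (levelStab p (n + 1)).relIndex (levelStab p n ⊓ B) * (levelStab p n).relIndex B := by
  have h := Subgroup.relIndex_mul_relIndex (levelStab p (n + 1) ⊓ B) (levelStab p n ⊓ B) B
    (inf_le_inf_right B (levelStab_antitone n.le_succ)) inf_le_right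
  rw [Subgroup.inf_relIndex_right, Subgroup.inf_relIndex_right] at h
  rw [← h]
  congr 1
  refine congrArg Subgroup.index (Subgroup.ext fun g => ?_)
  exact and_iff_left g.2.2

theorem relIndex_levelStab_zero {p : ℕ} (B : Subgroup (TreeAut p)) : (levelStab p 0).relIndex B = 1 :=
  Subgroup.relIndex_eq_one.2 fun g _ => mem_levelStab_zero g

theorem card_labels (n : ℕ) :
    Nat.card ({v : Vertex p // v.length = n} → Subgroup.zpowers (finRotate p)) = p ^ p ^ n := by
  rw [Nat.card_fun, card_zpowers_finRotate, natCard_level]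

/-- The labels of level `n` identify `St(n)/St(n+1)` in `W_p` with all `p ^ n`-tuples in a group of
order `p`; `spreadAut` realizes each tuple. -/
theorem relIndex_levelStab_padicAut_succ (n : ℕ) :
    (levelStab p (n + 1)).relIndex (padicAut p) =
      p ^ p ^ n * (levelStab p n).relIndex (padicAut p) := by
  rw [relIndex_levelStab_succ]
  congr 1
  have hker : (labelHom (le_refl (padicAut p)) (id : {v : Vertex p // v.length = n} → _)).ker =
      (levelStab p (n + 1)).subgroupOf (levelStab p n ⊓ padicAut p) := by
    ext g
    rw [Subgroup.mem_subgroupOf, levelStab_succ_iff g.2.1, MonoidHom.mem_ker]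
    constructor
    · intro h v hv
      exact congrArg Subtype.val (congrFun h ⟨v, hv⟩)
    · intro h
      exact funext fun v => Subtype.ext (h v.1 v.2)
  have hsurj : Function.Surjective
      (labelHom (le_refl (padicAut p)) (id : {v : Vertex p // v.length = n} → _)) := by
    intro c
    let c' : Vertex p → Equiv.Perm (Fin p) := fun v => if h : v.length = n then c ⟨v, h⟩ else 1
    have hmem : spreadAut n c' ∈ padicAut p := by
      intro v
      rw [label_spreadAut]
      by_cases h : v.length = n
      · simp only [c', h, if_true, dif_pos]
        exact (c _).2
      · rw [if_neg h]
        exact one_mem _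
    refine ⟨⟨spreadAut n c', spreadAut_mem_levelStab n c', hmem⟩, ?_⟩
    refine funext fun v => Subtype.ext ?_
    change (spreadAut n c').label v.1 = _
    rw [label_spreadAut, if_pos v.2]
    exact dif_pos v.2
  rw [Subgroup.relIndex, ← hker, Subgroup.index_ker, MonoidHom.range_eq_top.2 hsurj,
    Subgroup.card_top, card_labels]

/-- If `p ^ m` labels detect membership in `St(n+1)`, then `St_B(n)/St_B(n+1)` has at most `p ^ p ^
m` elements. -/
theorem relIndex_levelStab_succ_le {B : Subgroup (TreeAut p)} (hB : B ≤ padicAut p) {n m : ℕ}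
    (e : {v : Vertex p // v.length = m} → {v : Vertex p // v.length = n})
    (he : ∀ g ∈ B, g ∈ levelStab p n → (∀ i, g.label (e i).1 = 1) → g ∈ levelStab p (n + 1)) :
    (levelStab p (n + 1)).relIndex B ≤ p ^ p ^ m * (levelStab p n).relIndex B := by
  rw [relIndex_levelStab_succ]
  refine Nat.mul_le_mul_right _ ?_
  have hker : (labelHom hB e).ker ≤ (levelStab p (n + 1)).subgroupOf (levelStab p n ⊓ B) := by
    intro g hg
    refine Subgroup.mem_subgroupOf.2 (he g.1 g.2.2 g.2.1 fun i => ?_)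
    exact congrArg Subtype.val (congrFun (MonoidHom.mem_ker.1 hg) i)
  have hfin : (labelHom hB e).ker.FiniteIndex := inferInstance
  refine (Subgroup.index_antitone hker).trans ?_
  rw [Subgroup.index_ker, ← card_labels]
  exact Nat.card_le_card_of_injective _ Subtype.val_injective

theorem relIndex_levelStab_succ_le_of_tied {G : Subgroup (TreeAut p)} (hGW : G ≤ padicAut p)
    (hG : IsSelfSimilar G) (hT : FirstLevelLabelsTied G) (n : ℕ) :
    (levelStab p (n + 2)).relIndex G ≤ p ^ p ^ n * (levelStab p (n + 1)).relIndex G := by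
  -- One child `u z` per vertex `u` of level `n` suffices: tiedness of the section at `u` controls
  -- its siblings.
  let z : Fin p := ⟨0, hp.out.pos⟩
  refine relIndex_levelStab_succ_le hGW (n := n + 1) (m := n)
    (fun v => ⟨v.1 ++ [z], by simp [v.2]⟩) ?_
  intro g hg hgn hl
  refine (levelStab_succ_iff hgn).2 fun v hv => ?_
  have hne : v ≠ [] := by
    rintro rfl
    simp at hv
  obtain ⟨u, x, rfl⟩ : ∃ u x, v = u ++ [x] := ⟨_, _, (List.dropLast_append_getLast hne).symm⟩
  have hu : u.length = n := by simpa using hv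
  have hlab : ∀ y, g.label (u ++ [y]) = (g.sec u).label [y] := by
    intro y
    have h1 : g.sec (u ++ [y]) = (g.sec u).sec [y] := TreeAut.sec_unique fun w => by
      rw [List.append_assoc, TreeAut.sec_spec g u, TreeAut.sec_spec (g.sec u), ← List.append_assoc,
        ← TreeAut.sec_spec g u]
    rw [TreeAut.label, h1, TreeAut.label]
  rw [hlab]
  refine hT _ (hG g hg u) (fun w hw => ?_) z x ?_
  · have h1 := hgn (u ++ w) (by simp [hu, hw])
    rw [TreeAut.sec_spec, levelStab_antitone n.le_succ hgn u hu] at h1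
    exact List.append_cancel_left h1
  · rw [← hlab]
    exact hl ⟨u, hu⟩

/-- From level `n + 1` to `n + 2` the index in `G` gains at most `p ^ p ^ n`, whose `p`-th power is
exactly the gain in `W_p`. The factor `p ^ p` absorbs the first level, where tiedness gives nothing.
-/
theorem relIndex_levelStab_pow_le_of_tied {G : Subgroup (TreeAut p)} (hGW : G ≤ padicAut p)
    (hG : IsSelfSimilar G) (hT : FirstLevelLabelsTied G) (n : ℕ) :
    (levelStab p (n + 1)).relIndex G ^ p ≤
      p ^ p * (levelStab p (n + 1)).relIndex (padicAut p) := by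
  induction n with
  | zero =>
    have h1 : (levelStab p 1).relIndex G ≤ p := by
      have := relIndex_levelStab_succ_le hGW (n := 0) (m := 0) id fun g _ hg h =>
        (levelStab_succ_iff hg).2 fun v hv => h ⟨v, hv⟩
      simpa [relIndex_levelStab_zero] using this
    refine (Nat.pow_le_pow_left h1 p).trans (Nat.le_mul_of_pos_right _ ?_)
    rw [relIndex_levelStab_padicAut_succ, relIndex_levelStab_zero]
    exact Nat.mul_pos (pow_pos hp.out.pos _) one_pos
  | succ n ih =>
    calc (levelStab p (n + 2)).relIndex G ^ p
        ≤ (p ^ p ^ n * (levelStab p (n + 1)).relIndex G) ^ p :=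
          Nat.pow_le_pow_left (relIndex_levelStab_succ_le_of_tied hGW hG hT n) p
      _ = p ^ p ^ (n + 1) * (levelStab p (n + 1)).relIndex G ^ p := by
          rw [mul_pow, ← pow_mul, ← pow_succ]
      _ ≤ p ^ p ^ (n + 1) * (p ^ p * (levelStab p (n + 1)).relIndex (padicAut p)) :=
          Nat.mul_le_mul_left _ ih
      _ = p ^ p * (levelStab p (n + 2)).relIndex (padicAut p) := by
          rw [relIndex_levelStab_padicAut_succ (n + 1), mul_left_comm]

theorem relIndex_levelStab_padicAut_strictMono :
    StrictMono fun n => (levelStab p n).relIndex (padicAut p) := by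
  have hpos : ∀ n, 0 < (levelStab p n).relIndex (padicAut p) := by
    intro n
    induction n with
    | zero => rw [relIndex_levelStab_zero]; exact one_pos
    | succ n ih =>
      rw [relIndex_levelStab_padicAut_succ]
      exact Nat.mul_pos (pow_pos hp.out.pos _) ih
  refine strictMono_nat_of_lt_succ fun n => ?_
  rw [relIndex_levelStab_padicAut_succ]
  exact lt_mul_of_one_lt_left (hpos n) (Nat.one_lt_pow (pow_pos hp.out.pos n).ne' hp.out.one_lt)

end Indices

/-! ### The dimension bound for tied groups. -/

section Dimension

variable {p : ℕ} [hp : Fact p.Prime]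

open MeasureTheory Filter Topology

/-- The indices in `W_p` increase strictly, so a distance below `1 / |W_p : St(n)|` is witnessed at
a level beyond `n`. -/
theorem mem_levelStab_of_edist_lt {g h : padicAut p} {n : ℕ}
    (H : edist g h < ((levelStab p n).relIndex (padicAut p) : ℝ≥0∞)⁻¹) :
    g.1⁻¹ * h.1 ∈ levelStab p n := by
  by_cases hgh : g = h
  · rw [hgh, inv_mul_cancel]
    exact one_mem _
  change padicEDist g h < _ at H
  rw [padicEDist_of_ne hgh, iInf_lt_iff] at H
  obtain ⟨m, hm⟩ := H
  rw [ENNReal.inv_lt_inv, Nat.cast_lt, relIndex_levelStab_padicAut_strictMono.lt_iff_lt] at hm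
  exact levelStab_antitone hm.le m.2

/-- The closure is covered by `|G : St_G(n+1)|` cosets of diameter at most `1 / |W_p : St(n+1)|`.
The sums of the diameters to the power `1/p` stay below `p`, so the `1/p`-dimensional Hausdorff
measure is finite. -/
theorem dimH_closure_le_of_tied {G : Subgroup (TreeAut p)} (hGW : G ≤ padicAut p)
    (hG : IsSelfSimilar G) (hT : FirstLevelLabelsTied G) :
    dimH (closure (G.subgroupOf (padicAut p) : Set (padicAut p))) ≤ 1 / (p : ℝ≥0∞) := by
  borelize ↥(padicAut p)
  let a : ℕ → ℕ := fun n => (levelStab p (n + 1)).relIndex (padicAut p)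
  let ι : ℕ → Type := fun n => G ⧸ (levelStab p (n + 1)).subgroupOf G
  have : ∀ n, Fintype (ι n) := fun n => Fintype.ofFinite _
  let t : ∀ n, ι n → Set (padicAut p) := fun n q =>
    {h | (q.out : G).1⁻¹ * h.1 ∈ levelStab p (n + 1)}
  have hdiam : ∀ n i, Metric.ediam (t n i) ≤ (a n : ℝ≥0∞)⁻¹ := by
    intro n i
    refine Metric.ediam_le fun g hg h hh => padicEDist_le ?_
    have hg' : (i.out : G).1⁻¹ * g.1 ∈ levelStab p (n + 1) := hg
    have hh' : (i.out : G).1⁻¹ * h.1 ∈ levelStab p (n + 1) := hh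
    have h1 := mul_mem (inv_mem hg') hh'
    rwa [mul_inv_rev, inv_inv, mul_assoc, mul_inv_cancel_left] at h1
  have hcover : ∀ n, closure (G.subgroupOf (padicAut p) : Set (padicAut p)) ⊆ ⋃ i, t n i := by
    intro n h hh
    -- A point of the closure shares its coset of `St(n+1)` with an element of `G`, so the cosets
    -- met by `G` already cover.
    obtain ⟨g, hg, hgh⟩ := EMetric.mem_closure_iff.1 hh (a n : ℝ≥0∞)⁻¹
      (ENNReal.inv_pos.2 (ENNReal.natCast_ne_top _))
    have h1 := inv_mem (mem_levelStab_of_edist_lt hgh)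
    rw [mul_inv_rev, inv_inv] at h1
    let q : ι n := ((⟨g.1, hg⟩ : G) : ι n)
    refine Set.mem_iUnion.2 ⟨q, ?_⟩
    have h2 : (q.out : G)⁻¹ * ⟨g.1, hg⟩ ∈ (levelStab p (n + 1)).subgroupOf G :=
      QuotientGroup.eq.1 (QuotientGroup.out_eq' q)
    have h3 := mul_mem (Subgroup.mem_subgroupOf.1 h2) h1
    change (q.out : G).1⁻¹ * g.1 * (g.1⁻¹ * h.1) ∈ levelStab p (n + 1) at h3
    rwa [mul_assoc, mul_inv_cancel_left] at h3
  have ha : Tendsto (fun n => (a n : ℝ≥0∞)⁻¹) atTop (𝓝 0) :=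
    ENNReal.tendsto_inv_nat_nhds_zero.comp
      (relIndex_levelStab_padicAut_strictMono.tendsto_atTop.comp (tendsto_add_atTop_nat 1))
  have hp0 : (0 : ℝ) < p := Nat.cast_pos.2 hp.out.pos
  have hsum : ∀ n, ∑ i, Metric.ediam (t n i) ^ (1 / p : ℝ) ≤ (p : ℝ≥0∞) := by
    intro n
    have ha0 : a n ≠ 0 :=
      (Nat.zero_le _).trans_lt (relIndex_levelStab_padicAut_strictMono n.lt_succ_self) |>.ne'
    -- This is the `p`-th root of the index inequality for tied groups.
    have hcard : (Fintype.card (ι n) : ℝ≥0∞) ≤ p * (a n : ℝ≥0∞) ^ (1 / p : ℝ) := by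
      have h1 := relIndex_levelStab_pow_le_of_tied hGW hG hT n
      rw [← Nat.card_eq_fintype_card]
      have h2 : ((Nat.card (ι n) : ℕ) : ℝ≥0∞) ^ (p : ℝ) ≤
          (p * (a n : ℝ≥0∞) ^ (1 / p : ℝ)) ^ (p : ℝ) := by
        rw [ENNReal.mul_rpow_of_nonneg _ _ hp0.le, ← ENNReal.rpow_mul,
          one_div_mul_cancel hp0.ne', ENNReal.rpow_one, ENNReal.rpow_natCast,
          ENNReal.rpow_natCast]
        exact_mod_cast h1
      exact (ENNReal.rpow_le_rpow_iff hp0).1 h2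
    calc ∑ i, Metric.ediam (t n i) ^ (1 / p : ℝ)
        ≤ ∑ _i : ι n, ((a n : ℝ≥0∞)⁻¹) ^ (1 / p : ℝ) :=
          Finset.sum_le_sum fun i _ => ENNReal.rpow_le_rpow (hdiam n i) (by positivity)
      _ = Fintype.card (ι n) * ((a n : ℝ≥0∞) ^ (1 / p : ℝ))⁻¹ := by
          rw [Finset.sum_const, Finset.card_univ, nsmul_eq_mul, ENNReal.inv_rpow]
      _ ≤ p * (a n : ℝ≥0∞) ^ (1 / p : ℝ) * ((a n : ℝ≥0∞) ^ (1 / p : ℝ))⁻¹ :=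
          mul_le_mul_left hcard _
      _ = p := by
          rw [mul_assoc, ENNReal.mul_inv_cancel, mul_one]
          · exact (ENNReal.rpow_pos (by exact_mod_cast Nat.pos_of_ne_zero ha0)
              (ENNReal.natCast_ne_top _)).ne'
          · exact ENNReal.rpow_ne_top_of_nonneg (by positivity) (ENNReal.natCast_ne_top _)
  have hμ := Measure.hausdorffMeasure_le_liminf_sum (1 / p : ℝ)
    (closure (G.subgroupOf (padicAut p) : Set (padicAut p))) _ ha t
    (Eventually.of_forall hdiam) (Eventually.of_forall hcover)
  have hlim : liminf (fun n => ∑ i, Metric.ediam (t n i) ^ (1 / p : ℝ)) atTop ≤ (p : ℝ≥0∞) :=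
    (liminf_le_liminf (Eventually.of_forall hsum)).trans (liminf_const _).le
  have hne : Measure.hausdorffMeasure (((1 / p : NNReal)) : ℝ)
      (closure (G.subgroupOf (padicAut p) : Set (padicAut p))) ≠ ∞ := by
    have hc : ((1 / p : NNReal) : ℝ) = 1 / p := by simp
    rw [hc]
    exact ((hμ.trans hlim).trans_lt (ENNReal.natCast_lt_top p)).ne
  refine (dimH_le_of_hausdorffMeasure_ne_top hne).trans (le_of_eq ?_)
  have hpn : (p : NNReal) ≠ 0 := Nat.cast_ne_zero.2 hp.out.ne_zero
  rw [ENNReal.coe_div hpn, ENNReal.coe_one, ENNReal.coe_natCast]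

end Dimension

theorem mainTheorem7 (p : ℕ) [Fact p.Prime] (G : Subgroup (TreeAut p))
    (hGW : G ≤ padicAut p) (hfractal : IsFractal G) (hbranch : IsWeaklyBranch G)
    (hdim : 1 / (p : ℝ≥0∞) <
      hdimW (closure (G.subgroupOf (padicAut p) : Set (padicAut p)))) :
    IsTreeRigid p G :=
  hfractal.isTreeRigid hGW hbranch fun hT =>
    (dimH_closure_le_of_tied hGW hfractal.1 hT).not_gt hdim
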